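/- An inverse semigroup is a semigroup $S$ in which every $s$ has a unique $s^*$ with $ss^*s=s$ and $s^*ss^*=s^*$; write $E(S)$ for its set of idempotents and $s\le t$ if $s=ts^*s$. A topological partial action of $S$ on a locally compact Hausdorff space $X$ consists of open sets $X_s\subseteq X$ and homeomorphisms $\theta_s:X_{s^*}\to X_s$ ($s\in S$) such that $X=\bigcup_{e\in E(S)}X_e$ and, for all $s,t\in S$, $\theta_s(X_{s^*}\cap X_t)=X_s\cap X_{st}$, and $\theta_s(\theta_t(x))$ is defined and equal to $\theta_{st}(x)$ for all $x\in X_{t^*}\cap X_{t^*s^*}$. It is topologically principal if the set $$\Lambda(\theta)=\{x\in X \mid \text{for every } s\in S \text{ with } x\in X_{s^*} \text{ and } \theta_s(x)=x \text{ there is } e\in E(S) \text{ with } e\le s \text{ and } x\in X_e\}$$ is dense in $X$. Let $R$ be a non-zero commutative ring with unit and let $X$ be a Hausdorff space with a basis of compact-open sets. Let $\mathcal L_c(X)$ be the $R$-algebra of locally constant, compactly supported functions $X\to R$, and put $\operatorname{supp} f=\{x \mid f(x)\ne 0\}$. The partial action $\theta$ induces a partial action $\alpha$ of $S$ on $\mathcal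 L_c(X)$ by the ideals $D_s=\{f \mid \operatorname{supp} f\subseteq X_s\}$ and the ring isomorphisms $\alpha_s:D_{s^*}\to D_s$, where $\alpha_s(f)=f\circ\theta_{s^*}$ on $X_s$ and $\alpha_s(f)=0$ elsewhere. Let $\mathcal L$ be the ring of finite formal sums $\sum_s a_s\delta_s$ with $a_s\in D_s$, with componentwise addition and the product determined by $(a\delta_s)(b\delta_t)=\alpha_s(\alpha_{s^*}(a)b)\delta_{st}$, and let $\mathcal N$ be the ideal of $\mathcal L$ generated by all $a\delta_r-a\delta_s$ with $r\le s$ and $a\in D_r$. The skew inverse semigroup ring is $\mathcal L_c(X)\rtimes_\alpha S=\mathcal L/\mathcal N$. Its diagonal $\mathcal D$ is the set of all finite sums of classes $\overline{a\delta_e}$ with $e\in E(S)$ and $a\in D_e$, and $\widetilde\tau:\mathcal L_c(X)\rtimes_\alpha S\to\mathcal L_c(X)$ is the well-defined additive map $\overline{\sum_s a_s\delta_s}\mapsto\sum_s a_s$. A subset of a ring is maximal commutative if it is equal to its own centralizer. **Proposition.** Let $S$ be a countable inverse semigroup, let $X$ be a second-countable, locally compact Hausdorff space with a basis of compact-open sets,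 let $R$ be a non-zero commutative ring with unit, and let $\theta=(\{\theta_s\}_{s\in S},\{X_s\}_{s\in S})$ be a topological partial action of $S$ on $X$. If the diagonal $\mathcal D$ is maximal commutative in $\mathcal L_c(X)\rtimes_\alpha S$, then $\theta$ is topologically principal, and every non-zero two-sided ideal $\mathcal I$ of $\mathcal L_c(X)\rtimes_\alpha S$ contains an element $f$ with $\operatorname{supp}(\widetilde\tau(f))\ne\emptyset$. -/

import Mathlib

/-- An inverse semigroup: every `s` has a unique `t` with `s t s = s` and `t s t = t`,
written `s⁻¹` (also denoted `s^*`). -/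
class InverseSemigroup (S : Type*) extends Semigroup S, Inv S where
  mul_inv_mul : ∀ s : S, s * s⁻¹ * s = s
  inv_mul_inv : ∀ s : S, s⁻¹ * s * s⁻¹ = s⁻¹
  eq_inv : ∀ s t : S, s * t * s = s → t * s * t = t → t = s⁻¹

namespace InverseSemigroup

variable {S : Type*} [InverseSemigroup S]

/-- The natural partial order `s ≤ t ↔ s = t s⁻¹ s` of an inverse semigroup. -/
instance : LE S := ⟨fun s t => s = t * s⁻¹ * s⟩

theorem le_def (s t : S) : s ≤ t ↔ s = t * s⁻¹ * s := Iff.rfl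

theorem inv_inv' (s : S) : s⁻¹⁻¹ = s :=
  (eq_inv s⁻¹ s (inv_mul_inv s) (mul_inv_mul s)).symm

theorem mul_inv_mul' (s : S) : s * (s⁻¹ * s) = s := by
  rw [← mul_assoc]; exact mul_inv_mul s

theorem inv_mul_idem (s : S) : IsIdempotentElem (s⁻¹ * s) := by
  show s⁻¹ * s * (s⁻¹ * s) = s⁻¹ * s
  rw [← mul_assoc, inv_mul_inv]

theorem mul_inv_idem (s : S) : IsIdempotentElem (s * s⁻¹) := by
  show s * s⁻¹ * (s * s⁻¹) = s * s⁻¹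
  rw [← mul_assoc, mul_inv_mul]

theorem inv_of_idem {e : S} (he : IsIdempotentElem e) : e⁻¹ = e := by
  have h : e * e = e := he
  exact (eq_inv e e (by rw [h, h]) (by rw [h, h])).symm

theorem mul_idem {e f : S} (he : IsIdempotentElem e) (hf : IsIdempotentElem f) :
    IsIdempotentElem (e * f) := by
  have he' : e * e = e := he
  have hf' : f * f = f := hf
  set x := (e * f)⁻¹ with hx
  have h1 : e * f * x * (e * f) = e * f := mul_inv_mul _
  have h2 : x * (e * f) * x = x := inv_mul_inv _
  have h3 : f * x * e = x := by
    apply eq_inv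
    · calc e * f * (f * x * e) * (e * f) = e * (f * f) * x * ((e * e) * f) := by
            simp only [mul_assoc]
        _ = e * f := by rw [he', hf', h1]
    · calc f * x * e * (e * f) * (f * x * e) = f * (x * ((e * e) * (f * f)) * x) * e := by
            simp only [mul_assoc]
        _ = f * x * e := by rw [he', hf', h2]
  have hxx : IsIdempotentElem x := by
    show x * x = x
    calc x * x = (f * x * e) * (f * x * e) := by rw [h3]
      _ = f * (x * (e * f) * x) * e := by simp only [mul_assoc]
      _ = x := by rw [h2, h3]
  have h4 : x = e * f := by
    rw [← inv_of_idem hxx, hx, inv_inv']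
  rw [← h4]; exact hxx

theorem idem_comm {e f : S} (he : IsIdempotentElem e) (hf : IsIdempotentElem f) :
    e * f = f * e := by
  have he' : e * e = e := he
  have hf' : f * f = f := hf
  have h1 : e * f * (e * f) = e * f := mul_idem he hf
  have h2 : f * e * (f * e) = f * e := mul_idem hf he
  have h3 : f * e = (e * f)⁻¹ := by
    apply eq_inv
    · calc e * f * (f * e) * (e * f) = e * (f * f) * ((e * e) * f) := by simp only [mul_assoc]
        _ = e * f := by rw [he', hf', h1]
    · calc f * e * (e * f) * (f * e) = f * (e * e) * ((f * f) * e) := by simp only [mul_assoc]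
        _ = f * e := by rw [he', hf', h2]
  rw [h3, inv_of_idem (mul_idem he hf)]

theorem mul_inv_rev' (s t : S) : (s * t)⁻¹ = t⁻¹ * s⁻¹ := by
  have hc : (t * t⁻¹) * (s⁻¹ * s) = (s⁻¹ * s) * (t * t⁻¹) :=
    idem_comm (mul_inv_idem t) (inv_mul_idem s)
  symm
  apply eq_inv
  · calc s * t * (t⁻¹ * s⁻¹) * (s * t) = s * ((t * t⁻¹) * (s⁻¹ * s)) * t := by
          simp only [mul_assoc]
      _ = (s * s⁻¹ * s) * (t * t⁻¹ * t) := by rw [hc]; simp only [mul_assoc]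
      _ = s * t := by rw [mul_inv_mul, mul_inv_mul]
  · calc t⁻¹ * s⁻¹ * (s * t) * (t⁻¹ * s⁻¹) = t⁻¹ * ((s⁻¹ * s) * (t * t⁻¹)) * s⁻¹ := by
          simp only [mul_assoc]
      _ = (t⁻¹ * t * t⁻¹) * (s⁻¹ * s * s⁻¹) := by rw [← hc]; simp only [mul_assoc]
      _ = t⁻¹ * s⁻¹ := by rw [inv_mul_inv, inv_mul_inv]

theorem mul_idem_le (s : S) {f : S} (hf : IsIdempotentElem f) : s * f ≤ s := by
  have hf' : f * f = f := hf
  rw [le_def, mul_inv_rev', inv_of_idem hf]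
  symm
  calc s * (f * s⁻¹) * (s * f) = s * (f * (s⁻¹ * s)) * f := by simp only [mul_assoc]
    _ = (s * s⁻¹ * s) * (f * f) := by
        rw [idem_comm hf (inv_mul_idem s)]; simp only [mul_assoc]
    _ = s * f := by rw [mul_inv_mul, hf']

theorem mul_le_left {r s : S} (t : S) (h : r ≤ s) : t * r ≤ t * s := by
  rw [le_def, mul_assoc] at h
  have := mul_idem_le (t * s) (inv_mul_idem r)
  rwa [mul_assoc, ← h] at this

theorem mul_le_right {r s : S} (u : S) (h : r ≤ s) : r * u ≤ s * u := by
  rw [le_def, mul_assoc] at h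
  have hc := idem_comm (inv_mul_idem r) (mul_inv_idem u)
  have hg : IsIdempotentElem (u⁻¹ * (r⁻¹ * r) * u) := by
    show u⁻¹ * (r⁻¹ * r) * u * (u⁻¹ * (r⁻¹ * r) * u) = u⁻¹ * (r⁻¹ * r) * u
    calc u⁻¹ * (r⁻¹ * r) * u * (u⁻¹ * (r⁻¹ * r) * u)
        = u⁻¹ * ((r⁻¹ * r) * (u * u⁻¹)) * (r⁻¹ * r) * u := by simp only [mul_assoc]
      _ = (u⁻¹ * u * u⁻¹) * ((r⁻¹ * r) * (r⁻¹ * r)) * u := by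
          rw [hc]; simp only [mul_assoc]
      _ = u⁻¹ * (r⁻¹ * r) * u := by
          rw [inv_mul_inv, show (r⁻¹ * r) * (r⁻¹ * r) = r⁻¹ * r from inv_mul_idem r]
  have := mul_idem_le (s * u) hg
  have e : s * u * (u⁻¹ * (r⁻¹ * r) * u) = r * u := by
    calc s * u * (u⁻¹ * (r⁻¹ * r) * u) = s * ((u * u⁻¹) * (r⁻¹ * r)) * u := by
          simp only [mul_assoc]
      _ = (s * (r⁻¹ * r)) * (u * u⁻¹ * u) := by rw [← hc]; simp only [mul_assoc]
      _ = r * u := by rw [← h, mul_inv_mul]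
  rwa [e] at this

end InverseSemigroup

open InverseSemigroup

/-- A partial action of an inverse semigroup `S` on a ring `A`: ideals `D s` and ring isomorphisms
`π s : D s⁻¹ ≃ D s`. In `comp` the two membership claims say that both sides of
`π s (π t x) = π (s t) x` are defined. -/
structure RingPartialAction (S A : Type*) [InverseSemigroup S] [NonUnitalRing A] where
  D : S → TwoSidedIdeal A
  π : ∀ s, D s⁻¹ ≃+* D s
  generate : AddSubgroup.closure (⋃ e ∈ {e : S | IsIdempotentElem e}, (D e : Set A)) = ⊤
  image : ∀ s t, (fun x : D s⁻¹ => (π s x : A)) '' {x | (x : A) ∈ D t} =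
    (D s : Set A) ∩ (D (s * t) : Set A)
  comp : ∀ (s t : S) (x : A) (hx : x ∈ D t⁻¹), x ∈ D (t⁻¹ * s⁻¹) →
    ∃ (h₁ : (π t ⟨x, hx⟩ : A) ∈ D s⁻¹) (h₂ : x ∈ D (s * t)⁻¹),
      (π s ⟨π t ⟨x, hx⟩, h₁⟩ : A) = π (s * t) ⟨x, h₂⟩

namespace RingPartialAction

variable {S A : Type*} [InverseSemigroup S] [NonUnitalRing A] (P : RingPartialAction S A)

theorem π_mem {s t : S} (x : P.D s⁻¹) (hx : (x : A) ∈ P.D t) : (P.π s x : A) ∈ P.D (s * t) := by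
  have : (P.π s x : A) ∈ (fun x : P.D s⁻¹ => (P.π s x : A)) '' {x | (x : A) ∈ P.D t} :=
    ⟨x, hx, rfl⟩
  rw [P.image] at this
  exact this.2

theorem mem_mul_inv {s : S} {x : A} (hx : x ∈ P.D s) : x ∈ P.D (s * s⁻¹) := by
  have := P.π_mem ((P.π s).symm ⟨x, hx⟩) ((P.π s).symm ⟨x, hx⟩).2
  simpa using this

theorem π_congr {s t : S} (h : s = t) (x : A) (hx : x ∈ P.D s⁻¹) (hx' : x ∈ P.D t⁻¹) :
    (P.π s ⟨x, hx⟩ : A) = P.π t ⟨x, hx'⟩ := by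
  subst h; rfl

theorem π_idem {e : S} (he : IsIdempotentElem e) (x : P.D e⁻¹) : (P.π e x : A) = x := by
  have he' : e * e = e := he
  obtain ⟨x, hx⟩ := x
  obtain ⟨h₁, h₂, h⟩ := P.comp e e x hx (by
    rw [inv_of_idem he] at hx ⊢; rwa [he'])
  rw [P.π_congr he' x h₂ hx] at h
  have := (P.π e).injective (Subtype.ext h)
  exact congrArg Subtype.val this

theorem restrict {r s : S} (h : r ≤ s) (x : A) (hx : x ∈ P.D r⁻¹) :
    ∃ h' : x ∈ P.D s⁻¹, (P.π r ⟨x, hx⟩ : A) = P.π s ⟨x, h'⟩ := by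
  rw [le_def, mul_assoc] at h
  have hi := inv_mul_idem r
  have hx1 : x ∈ P.D (r⁻¹ * r)⁻¹ := by
    rw [inv_of_idem hi]
    simpa [inv_inv'] using P.mem_mul_inv hx
  have hx2 : x ∈ P.D ((r⁻¹ * r)⁻¹ * s⁻¹) := by
    rwa [← mul_inv_rev', ← h]
  obtain ⟨h₁, h₂, e⟩ := P.comp s (r⁻¹ * r) x hx1 hx2
  have e1 := P.π_idem hi ⟨x, hx1⟩
  have h' : x ∈ P.D s⁻¹ := by rw [e1] at h₁; exact h₁
  refine ⟨h', ?_⟩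
  rw [P.π_congr h x hx h₂, ← e]
  congr 2
  exact Subtype.ext e1

theorem D_mono {r s : S} (h : r ≤ s) {x : A} (hx : x ∈ P.D r) : x ∈ P.D s := by
  obtain ⟨h', e⟩ := P.restrict h ((P.π r).symm ⟨x, hx⟩ : P.D r⁻¹) (Subtype.property _)
  simp only [Subtype.coe_eta, RingEquiv.apply_symm_apply] at e
  rw [e]; exact Subtype.property _

/-- `π_{s⁻¹} : D s → D s⁻¹`, with the domain `D s⁻¹⁻¹` rewritten as `D s`. -/
def πInv (s : S) (a : P.D s) : P.D s⁻¹ :=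
  P.π s⁻¹ ⟨a, by rw [inv_inv']; exact a.2⟩

theorem πInv_add (s : S) (a b : P.D s) : P.πInv s (a + b) = P.πInv s a + P.πInv s b := by
  unfold πInv
  rw [← map_add]
  rfl

theorem π_πInv (s : S) (a : P.D s) : P.π s (P.πInv s a) = a := by
  have h1 : (a : A) ∈ P.D s⁻¹⁻¹ := by rw [inv_inv']; exact a.2
  obtain ⟨h₁, h₂, e⟩ := P.comp s s⁻¹ a h1 (by rw [inv_inv']; exact P.mem_mul_inv a.2)
  rw [P.π_idem (mul_inv_idem s)] at e
  exact Subtype.ext e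

theorem restrict_inv {r s : S} (h : r ≤ s) (a : A) (hr : a ∈ P.D r) (hs : a ∈ P.D s) :
    (P.πInv r ⟨a, hr⟩ : A) = P.πInv s ⟨a, hs⟩ := by
  obtain ⟨h', e⟩ := P.restrict h (P.πInv r ⟨a, hr⟩) (Subtype.property _)
  rw [Subtype.coe_eta, π_πInv] at e
  have : P.π s ⟨P.πInv r ⟨a, hr⟩, h'⟩ = P.π s (P.πInv s ⟨a, hs⟩) := by
    rw [π_πInv]; exact Subtype.ext e.symm
  exact congrArg Subtype.val ((P.π s).injective this)

/-- The coefficient `π_s(π_{s⁻¹}(a) b) ∈ D (s t)` of `(a δ_s)(b δ_t)`. -/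
def coeffMul (s t : S) (a : P.D s) (b : P.D t) : P.D (s * t) :=
  ⟨P.π s ⟨P.πInv s a * b, (P.D s⁻¹).mul_mem_right _ _ (P.πInv s a).2⟩,
    P.π_mem _ ((P.D t).mul_mem_left _ _ b.2)⟩

theorem coeffMul_add_left (s t : S) (a a' : P.D s) (b : P.D t) :
    P.coeffMul s t (a + a') b = P.coeffMul s t a b + P.coeffMul s t a' b := by
  apply Subtype.ext
  show (P.π s _ : A) = (P.π s _ : A) + (P.π s _ : A)
  rw [← AddMemClass.coe_add, ← map_add]
  congr 2
  apply Subtype.ext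
  show (P.πInv s (a + a') : A) * b = P.πInv s a * b + P.πInv s a' * b
  rw [πInv_add, ← add_mul]; rfl

theorem coeffMul_add_right (s t : S) (a : P.D s) (b b' : P.D t) :
    P.coeffMul s t a (b + b') = P.coeffMul s t a b + P.coeffMul s t a b' := by
  apply Subtype.ext
  show (P.π s _ : A) = (P.π s _ : A) + (P.π s _ : A)
  rw [← AddMemClass.coe_add, ← map_add]
  congr 2
  apply Subtype.ext
  show (P.πInv s a : A) * (b + b' : A) = P.πInv s a * b + P.πInv s a * b'
  rw [mul_add]

/-- `coeffMul` as a biadditive map. -/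
def coeffMulHom (s t : S) : P.D s →+ P.D t →+ P.D (s * t) :=
  AddMonoidHom.mk' (fun a => AddMonoidHom.mk' (P.coeffMul s t a) (P.coeffMul_add_right s t a))
    (fun a a' => AddMonoidHom.ext fun b => P.coeffMul_add_left s t a a' b)

/-- The ring `𝓛` of finite formal sums `∑ a_s δ_s` with `a_s ∈ D s`. -/
def Formal : Type _ := DirectSum S fun s => P.D s

noncomputable section

namespace Formal

instance : AddCommGroup P.Formal := inferInstanceAs (AddCommGroup (DirectSum S fun s => P.D s))

/-- The homogeneous element `a δ_s`. -/
def single (s : S) : P.D s →+ P.Formal := by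
  classical exact DirectSum.of (fun s => P.D s) s

/-- The additive map on `𝓛` given on homogeneous elements by `φ`. -/
def lift {B : Type*} [AddCommMonoid B] (φ : ∀ s, P.D s →+ B) : P.Formal →+ B := by
  classical exact DirectSum.toAddMonoid φ

@[simp] theorem lift_single {B : Type*} [AddCommMonoid B] (φ : ∀ s, P.D s →+ B) (s : S)
    (a : P.D s) : lift P φ (single P s a) = φ s a := by
  classical exact DirectSum.toAddMonoid_of φ s a

theorem induction {p : P.Formal → Prop} (x : P.Formal) (zero : p 0)
    (single : ∀ s a, p (single P s a)) (add : ∀ x y, p x → p y → p (x + y)) : p x := by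
  classical exact DirectSum.induction_on x zero single add

/-- The multiplication of `𝓛` as a biadditive map. -/
def mulHom : P.Formal →+ P.Formal →+ P.Formal :=
  lift P fun s => AddMonoidHom.flip <| lift P fun t => AddMonoidHom.flip <|
    AddMonoidHom.mk' (fun a => (single P (s * t)).comp (P.coeffMulHom s t a))
      (fun a b => by rw [map_add, AddMonoidHom.comp_add])

instance : NonUnitalNonAssocRing P.Formal where
  mul x y := mulHom P x y
  left_distrib x y z := map_add (mulHom P x) y z
  right_distrib x y z := by
    show mulHom P (x + y) z = mulHom P x z + mulHom P y z
    rw [map_add]; rfl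
  zero_mul x := by
    show mulHom P 0 x = 0
    rw [map_zero]; rfl
  mul_zero x := map_zero (mulHom P x)

/-- `(a δ_s)(b δ_t) = π_s(π_{s⁻¹}(a) b) δ_{st}`. -/
theorem single_mul_single (s t : S) (a : P.D s) (b : P.D t) :
    single P s a * single P t b = single P (s * t) (P.coeffMul s t a b) := by
  show mulHom P (single P s a) (single P t b) = _
  simp [mulHom, coeffMulHom]

/-- `τ(∑ a_s δ_s) = ∑ a_s`. -/
def tau : P.Formal →+ A := lift P fun s => (P.D s).coeAddMonoidHom

@[simp] theorem tau_single (s : S) (a : P.D s) : tau P (single P s a) = a := by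
  simp [tau]

/-- The elements `a δ_r - a δ_s` with `r ≤ s` and `a ∈ D r`. -/
def nGen : Set P.Formal :=
  {x | ∃ (r s : S) (a : A) (hr : a ∈ P.D r) (h : r ≤ s),
    x = single P r ⟨a, hr⟩ - single P s ⟨a, P.D_mono h hr⟩}

/-- The ideal `𝓝` generated by the elements `a δ_r - a δ_s` with `r ≤ s` and `a ∈ D r`. -/
def N : TwoSidedIdeal P.Formal := TwoSidedIdeal.span (nGen P)

theorem single_mul_nGen (t : S) (b : P.D t) {x : P.Formal} (hx : x ∈ nGen P) :
    single P t b * x ∈ nGen P := by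
  obtain ⟨r, s, a, hr, h, rfl⟩ := hx
  refine ⟨t * r, t * s, P.coeffMul t r b ⟨a, hr⟩, Subtype.property _, mul_le_left t h, ?_⟩
  rw [mul_sub, single_mul_single, single_mul_single]
  rfl

theorem nGen_mul_single (u : S) (c : P.D u) {x : P.Formal} (hx : x ∈ nGen P) :
    x * single P u c ∈ nGen P := by
  obtain ⟨r, s, a, hr, h, rfl⟩ := hx
  refine ⟨r * u, s * u, P.coeffMul r u ⟨a, hr⟩ c, Subtype.property _, mul_le_right u h, ?_⟩
  rw [sub_mul, single_mul_single, single_mul_single]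
  congr 2
  apply Subtype.ext
  have hs := P.D_mono h hr
  have e := P.restrict_inv h a hr hs
  show (P.π s ⟨P.πInv s ⟨a, hs⟩ * c, _⟩ : A) = P.π r ⟨P.πInv r ⟨a, hr⟩ * c, _⟩
  obtain ⟨h', e'⟩ := P.restrict h (P.πInv r ⟨a, hr⟩ * c)
    ((P.D r⁻¹).mul_mem_right _ _ (Subtype.property _))
  rw [e']
  congr 2
  exact Subtype.ext (congrArg (· * (c : A)) e.symm)

theorem mul_mem_closure (y : P.Formal) {x : P.Formal} (hx : x ∈ AddSubgroup.closure (nGen P)) :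
    y * x ∈ AddSubgroup.closure (nGen P) ∧ x * y ∈ AddSubgroup.closure (nGen P) := by
  induction hx using AddSubgroup.closure_induction with
  | mem x hx =>
    induction y using induction P with
    | zero => simp [zero_mem]
    | single s a =>
      exact ⟨AddSubgroup.subset_closure (single_mul_nGen P s a hx),
        AddSubgroup.subset_closure (nGen_mul_single P s a hx)⟩
    | add y z hy hz =>
      rw [add_mul, mul_add]
      exact ⟨add_mem hy.1 hz.1, add_mem hy.2 hz.2⟩
  | zero => simp [zero_mem]
  | add x z _ _ hx hz =>
    rw [add_mul, mul_add]
    exact ⟨add_mem hx.1 hz.1, add_mem hx.2 hz.2⟩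
  | neg x _ hx =>
    rw [neg_mul, mul_neg]
    exact ⟨neg_mem hx.1, neg_mem hx.2⟩

theorem mem_closure_of_mem_N {x : P.Formal} (hx : x ∈ N P) :
    x ∈ AddSubgroup.closure (nGen P) := by
  let J : TwoSidedIdeal P.Formal := TwoSidedIdeal.mk' (AddSubgroup.closure (nGen P))
    (zero_mem _) add_mem neg_mem (fun {x y} hy => (mul_mem_closure P x hy).1)
    (fun {x y} hx => (mul_mem_closure P y hx).2)
  have hJ : N P ≤ J := by
    refine TwoSidedIdeal.span_le.2 fun y hy => ?_
    rw [TwoSidedIdeal.coe_mk']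
    exact AddSubgroup.subset_closure hy
  have := hJ hx
  rwa [TwoSidedIdeal.mem_mk'] at this

theorem tau_eq_zero {x : P.Formal} (hx : x ∈ N P) : tau P x = 0 := by
  have h : AddSubgroup.closure (nGen P) ≤ (tau P).ker := by
    rw [AddSubgroup.closure_le]
    rintro _ ⟨r, s, a, hr, h, rfl⟩
    simp [AddMonoidHom.mem_ker]
  exact h (mem_closure_of_mem_N P hx)

end Formal

/-- The skew inverse semigroup ring `A ⋊ S = 𝓛 / 𝓝`. -/
abbrev SkewRing : Type _ := (Formal.N P).ringCon.Quotient

namespace SkewRing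

/-- The class of an element of `𝓛`. -/
def mk (x : P.Formal) : P.SkewRing := (x : (Formal.N P).ringCon.Quotient)

/-- The additive map induced by `τ` on `A ⋊ S`. -/
def tau : P.SkewRing →+ A where
  toFun := Quotient.lift (Formal.tau P) fun x y h => by
    have : x - y ∈ Formal.N P := ((Formal.N P).rel_iff x y).1 h
    have := Formal.tau_eq_zero P this
    rwa [map_sub, sub_eq_zero] at this
  map_zero' := map_zero (Formal.tau P)
  map_add' x y := Quotient.inductionOn₂ x y fun a b => map_add (Formal.tau P) a b

@[simp] theorem tau_mk (x : P.Formal) : tau P (mk P x) = Formal.tau P x := rfl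

/-- The diagonal: all finite sums of classes of elements `a δ_e` with `e` idempotent, `a ∈ D e`. -/
def diagonal : AddSubmonoid P.SkewRing :=
  AddSubmonoid.closure {x | ∃ (e : S) (_ : IsIdempotentElem e) (a : P.D e),
    x = mk P (Formal.single P e a)}

end SkewRing

end

end RingPartialAction

/-- A subset of a ring is maximal commutative if it equals its own centralizer. -/
def IsMaximalCommutative {B : Type*} [Mul B] (M : Set B) : Prop :=
  Set.centralizer M = M

/-- A topological partial action of an inverse semigroup `S` on a space `X`: open sets `dom s`
(also denoted `X_s`) and homeomorphisms `θ s : dom s⁻¹ → dom s`. The values of `θ s` off `dom s⁻¹` are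
irrelevant; in `comp` the membership claim says that `θ s (θ t x)` is defined. -/
structure TopPartialAction (S X : Type*) [InverseSemigroup S] [TopologicalSpace X] where
  dom : S → Set X
  θ : S → OpenPartialHomeomorph X X
  source_eq : ∀ s, (θ s).source = dom s⁻¹
  target_eq : ∀ s, (θ s).target = dom s
  iUnion : ⋃ e ∈ {e : S | IsIdempotentElem e}, dom e = Set.univ
  image : ∀ s t, θ s '' (dom s⁻¹ ∩ dom t) = dom s ∩ dom (s * t)
  comp : ∀ s t, ∀ x ∈ dom t⁻¹ ∩ dom (t⁻¹ * s⁻¹),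
    θ t x ∈ dom s⁻¹ ∧ θ s (θ t x) = θ (s * t) x

/-- The algebra `𝓛_c(X)` of locally constant, compactly supported `R`-valued functions; here
`Function.support f = {x | f x ≠ 0}`. -/
def LocConstCompact (X R : Type*) [TopologicalSpace X] [T2Space X] [CommRing R] :
    NonUnitalSubalgebra R (X → R) where
  carrier := {f | IsLocallyConstant f ∧ IsCompact (Function.support f)}
  zero_mem' := ⟨IsLocallyConstant.zero, by simp⟩
  add_mem' := by
    rintro f g ⟨hf, hf'⟩ ⟨hg, hg'⟩
    have h : IsLocallyConstant (f + g) := hf.add hg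
    exact ⟨h, (hf'.union hg').of_isClosed_subset (h.isClopen_fiber 0).compl.1
      (Function.support_add f g)⟩
  mul_mem' := by
    rintro f g ⟨hf, hf'⟩ ⟨hg, hg'⟩
    have h : IsLocallyConstant (f * g) := hf.mul hg
    exact ⟨h, hf'.of_isClosed_subset (h.isClopen_fiber 0).compl.1
      (Function.support_mul_subset_left f g)⟩
  smul_mem' := by
    rintro c f ⟨hf, hf'⟩
    have h : IsLocallyConstant (c • f) := hf.comp (c • ·)
    exact ⟨h, hf'.of_isClosed_subset (h.isClopen_fiber 0).compl.1
      (Function.support_const_smul_subset c f)⟩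

namespace TopPartialAction

variable {S X : Type*} [InverseSemigroup S] [TopologicalSpace X] (T : TopPartialAction S X)

/-- The set `Λ(θ)` of points fixed only trivially. -/
def trivialIsotropy : Set X :=
  {x | ∀ s : S, x ∈ T.dom s⁻¹ → T.θ s x = x → ∃ e : S, IsIdempotentElem e ∧ e ≤ s ∧ x ∈ T.dom e}

/-- `θ` is topologically principal if `Λ(θ)` is dense. -/
def IsTopologicallyPrincipal : Prop := Dense T.trivialIsotropy

theorem isOpen_dom (s : S) : IsOpen (T.dom s) := T.target_eq s ▸ (T.θ s).open_target

theorem θ_mem {s : S} {x : X} (hx : x ∈ T.dom s⁻¹) : T.θ s x ∈ T.dom s := by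
  rw [← T.target_eq]; exact (T.θ s).map_source (by rwa [T.source_eq])

theorem θ_mem_mul {s t : S} {x : X} (hx : x ∈ T.dom s⁻¹) (hx' : x ∈ T.dom t) :
    T.θ s x ∈ T.dom (s * t) := by
  have : T.θ s x ∈ T.θ s '' (T.dom s⁻¹ ∩ T.dom t) := ⟨x, ⟨hx, hx'⟩, rfl⟩
  rw [T.image] at this
  exact this.2

theorem θ_inj {s : S} {x y : X} (hx : x ∈ T.dom s⁻¹) (hy : y ∈ T.dom s⁻¹)
    (h : T.θ s x = T.θ s y) : x = y :=
  (T.θ s).injOn (by rwa [T.source_eq]) (by rwa [T.source_eq]) h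

theorem exists_θ {s : S} {y : X} (hy : y ∈ T.dom s) : ∃ x ∈ T.dom s⁻¹, T.θ s x = y := by
  rw [← T.target_eq] at hy
  refine ⟨(T.θ s).symm y, ?_, (T.θ s).right_inv hy⟩
  rw [← T.source_eq]; exact (T.θ s).map_target hy

theorem mem_mul_inv {s : S} {x : X} (hx : x ∈ T.dom s) : x ∈ T.dom (s * s⁻¹) := by
  obtain ⟨z, hz, rfl⟩ := T.exists_θ hx
  exact T.θ_mem_mul hz hz

theorem θ_idem {e : S} (he : IsIdempotentElem e) {x : X} (hx : x ∈ T.dom e) : T.θ e x = x := by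
  have he' : e * e = e := he
  have hx' : x ∈ T.dom e⁻¹ := by rwa [inv_of_idem he]
  have h := T.comp e e x ⟨hx', by rwa [inv_of_idem he, he']⟩
  rw [he'] at h
  exact T.θ_inj h.1 hx' h.2

theorem θ_θ_inv {s : S} {x : X} (hx : x ∈ T.dom s) :
    T.θ s⁻¹ x ∈ T.dom s⁻¹ ∧ T.θ s (T.θ s⁻¹ x) = x := by
  have h := T.comp s s⁻¹ x ⟨by rwa [inv_inv'], by rw [inv_inv']; exact T.mem_mul_inv hx⟩
  rwa [T.θ_idem (mul_inv_idem s) (T.mem_mul_inv hx)] at h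

theorem θ_inv_θ {s : S} {x : X} (hx : x ∈ T.dom s⁻¹) : T.θ s⁻¹ (T.θ s x) = x := by
  have h := T.θ_θ_inv (T.θ_mem hx)
  exact T.θ_inj h.1 hx h.2

noncomputable section

variable {R : Type*} [CommRing R]

open Classical in
/-- The function equal to `f ∘ θ_{s⁻¹}` on `dom s` and to `0` elsewhere. -/
def transport (s : S) (f : X → R) : X → R := fun x => if x ∈ T.dom s then f (T.θ s⁻¹ x) else 0

theorem transport_apply {s : S} (f : X → R) {x : X} (hx : x ∈ T.dom s⁻¹) :
    T.transport s f (T.θ s x) = f x := by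
  rw [transport, if_pos (T.θ_mem hx), T.θ_inv_θ hx]

theorem transport_of_notMem {s : S} (f : X → R) {x : X} (hx : x ∉ T.dom s) :
    T.transport s f x = 0 := if_neg hx

theorem transport_support {s : S} {f : X → R} (hf : Function.support f ⊆ T.dom s⁻¹) :
    Function.support (T.transport s f) = T.θ s '' Function.support f := by
  ext x
  constructor
  · intro hx
    by_cases hxs : x ∈ T.dom s
    · obtain ⟨z, hz, rfl⟩ := T.exists_θ hxs
      rw [Function.mem_support, T.transport_apply f hz] at hx
      exact ⟨z, hx, rfl⟩
    · exact absurd (T.transport_of_notMem f hxs) hx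
  · rintro ⟨z, hz, rfl⟩
    rw [Function.mem_support, T.transport_apply f (hf hz)]
    exact hz

theorem transport_support_subset {s : S} (f : X → R) :
    Function.support (T.transport s f) ⊆ T.dom s := fun x hx => by
  by_contra h
  exact hx (T.transport_of_notMem f h)

variable [T2Space X]

theorem transport_mem {s : S} {f : X → R} (hf : f ∈ LocConstCompact X R)
    (hs : Function.support f ⊆ T.dom s⁻¹) : T.transport s f ∈ LocConstCompact X R := by
  have hc : IsCompact (Function.support (T.transport s f)) := by
    rw [T.transport_support hs]
    refine hf.2.image_of_continuousOn ((T.θ s).continuousOn.mono ?_)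
    rwa [T.source_eq]
  refine ⟨?_, hc⟩
  rw [IsLocallyConstant.iff_eventually_eq]
  intro x
  by_cases hx : x ∈ T.dom s
  · have hcont : ContinuousAt (T.θ s⁻¹) x :=
      (T.θ s⁻¹).continuousAt (by rw [T.source_eq, inv_inv']; exact hx)
    filter_upwards [(T.isOpen_dom s).mem_nhds hx,
      hcont.eventually (hf.1.eventually_eq (T.θ s⁻¹ x))] with y hy hy'
    rw [transport, transport, if_pos hx, if_pos hy, hy']
  · have hx' : x ∈ (Function.support (T.transport s f))ᶜ := fun h =>
      hx (T.transport_support_subset f h)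
    filter_upwards [hc.isClosed.isOpen_compl.mem_nhds hx'] with y hy
    rw [Function.notMem_support.1 hy, T.transport_of_notMem f hx]

variable (R) in
/-- The ideal `D s` of functions in `𝓛_c(X)` supported in `dom s`. -/
def supportIdeal (s : S) : TwoSidedIdeal (LocConstCompact X R) :=
  TwoSidedIdeal.mk' {f | Function.support (f : X → R) ⊆ T.dom s}
    (by simp)
    (fun {f g} hf hg => (Function.support_add (f : X → R) g).trans (Set.union_subset hf hg))
    (fun {f} hf => by
      show Function.support (-(f : X → R)) ⊆ _
      rw [Function.support_neg]; exact hf)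
    (fun {f g} hg => (Function.support_mul_subset_right (f : X → R) g).trans hg)
    (fun {f g} hf => (Function.support_mul_subset_left (f : X → R) g).trans hf)

theorem mem_supportIdeal {s : S} {f : LocConstCompact X R} :
    f ∈ T.supportIdeal R s ↔ Function.support (f : X → R) ⊆ T.dom s := by
  rw [supportIdeal, TwoSidedIdeal.mem_mk']; rfl

variable (R) in
/-- The ring isomorphism `α_s : D s⁻¹ → D s`, `α_s(f) = f ∘ θ_{s⁻¹}` on `dom s` and `0` off it. -/
def alpha (s : S) : T.supportIdeal R s⁻¹ ≃+* T.supportIdeal R s where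
  toFun f := ⟨⟨T.transport s f.1.1, T.transport_mem f.1.2 (T.mem_supportIdeal.1 f.2)⟩,
    T.mem_supportIdeal.2 (T.transport_support_subset _)⟩
  invFun f := ⟨⟨T.transport s⁻¹ f.1.1, T.transport_mem f.1.2 (by
      rw [inv_inv']; exact T.mem_supportIdeal.1 f.2)⟩,
    T.mem_supportIdeal.2 (T.transport_support_subset _)⟩
  left_inv f := by
    apply Subtype.ext; apply Subtype.ext; funext x
    show T.transport s⁻¹ (T.transport s f.1.1) x = f.1.1 x
    by_cases hx : x ∈ T.dom s⁻¹
    · rw [transport, if_pos hx, inv_inv', T.transport_apply _ hx]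
    · rw [T.transport_of_notMem _ hx]
      by_contra h
      exact hx (T.mem_supportIdeal.1 f.2 (Ne.symm h))
  right_inv f := by
    apply Subtype.ext; apply Subtype.ext; funext x
    show T.transport s (T.transport s⁻¹ f.1.1) x = f.1.1 x
    by_cases hx : x ∈ T.dom s
    · rw [transport, if_pos hx, T.transport_apply _ (by rwa [inv_inv'])]
    · rw [T.transport_of_notMem _ hx]
      by_contra h
      exact hx (T.mem_supportIdeal.1 f.2 (Ne.symm h))
  map_mul' f g := by
    apply Subtype.ext; apply Subtype.ext; funext x
    show T.transport s (f.1.1 * g.1.1) x = T.transport s f.1.1 x * T.transport s g.1.1 x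
    simp only [transport]
    split_ifs <;> simp
  map_add' f g := by
    apply Subtype.ext; apply Subtype.ext; funext x
    show T.transport s (f.1.1 + g.1.1) x = T.transport s f.1.1 x + T.transport s g.1.1 x
    simp only [transport]
    split_ifs <;> simp

theorem alpha_coe (s : S) (f : T.supportIdeal R s⁻¹) :
    ((T.alpha R s f : LocConstCompact X R) : X → R) = T.transport s f.1.1 := rfl

theorem indicator_mem {f : X → R} (hf : f ∈ LocConstCompact X R) {V : Set X} (hV : IsClopen V) :
    V.indicator f ∈ LocConstCompact X R := by
  have h : IsLocallyConstant (V.indicator f) :=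
    (LocallyConstant.indicator (⟨f, hf.1⟩ : LocallyConstant X R) hV).isLocallyConstant
  refine ⟨h, hf.2.of_isClosed_subset (h.isClopen_fiber 0).compl.1 ?_⟩
  rw [Set.support_indicator]
  exact Set.inter_subset_right

variable [PrespectralSpace X]

theorem supportIdeal_generate : AddSubgroup.closure
    (⋃ e ∈ {e : S | IsIdempotentElem e}, (T.supportIdeal R e : Set (LocConstCompact X R))) = ⊤ := by
  set G := AddSubgroup.closure
    (⋃ e ∈ {e : S | IsIdempotentElem e}, (T.supportIdeal R e : Set (LocConstCompact X R)))
  rw [eq_top_iff]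
  rintro f -
  have key : ∃ V : Set X, IsClopen V ∧ Function.support (f : X → R) ⊆ V ∧
      ∀ g : LocConstCompact X R, Function.support (g : X → R) ⊆ V → g ∈ G := by
    refine IsCompact.induction_on
      (p := fun K => ∃ V : Set X, IsClopen V ∧ K ⊆ V ∧
        ∀ g : LocConstCompact X R, Function.support (g : X → R) ⊆ V → g ∈ G) f.2.2 ?_ ?_ ?_ ?_
    · refine ⟨∅, isClopen_empty, le_rfl, fun g hg => ?_⟩
      have : g = 0 := Subtype.ext (Function.support_eq_empty_iff.1 (Set.subset_empty_iff.1 hg))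
      rw [this]; exact zero_mem _
    · rintro K K' hK ⟨V, h1, h2, h3⟩
      exact ⟨V, h1, hK.trans h2, h3⟩
    · rintro K K' ⟨V, h1, h2, h3⟩ ⟨V', h1', h2', h3'⟩
      refine ⟨V ∪ V', h1.union h1', Set.union_subset_union h2 h2', fun g hg => ?_⟩
      have e : g = ⟨_, indicator_mem g.2 h1⟩ + ⟨_, indicator_mem g.2 h1.compl⟩ :=
        Subtype.ext (Set.indicator_self_add_compl V (g : X → R)).symm
      rw [e]
      refine add_mem (h3 _ ?_) (h3' _ ?_)
      · show Function.support (V.indicator (g : X → R)) ⊆ V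
        rw [Set.support_indicator]; exact Set.inter_subset_left
      · show Function.support (Vᶜ.indicator (g : X → R)) ⊆ V'
        rw [Set.support_indicator]
        rintro x ⟨hx, hx'⟩
        exact (hg hx').resolve_left hx
    · intro x _
      have hx : x ∈ ⋃ e ∈ {e : S | IsIdempotentElem e}, T.dom e := T.iUnion ▸ Set.mem_univ x
      simp only [Set.mem_iUnion] at hx
      obtain ⟨e, he, hx⟩ := hx
      obtain ⟨K, ⟨hKo, hKc⟩, hxK, hK⟩ :=
        PrespectralSpace.isTopologicalBasis.exists_subset_of_mem_open hx (T.isOpen_dom e)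
      refine ⟨K, mem_nhdsWithin_of_mem_nhds (hKo.mem_nhds hxK), K, ⟨hKc.isClosed, hKo⟩, le_rfl,
        fun g hg => AddSubgroup.subset_closure ?_⟩
      simp only [Set.mem_iUnion]
      exact ⟨e, he, T.mem_supportIdeal.2 (hg.trans hK)⟩
  obtain ⟨V, -, h2, h3⟩ := key
  exact h3 f h2

variable (R) in
/-- The partial action `α` of `S` on `𝓛_c(X)` associated with `θ`. -/
def toRingPartialAction : RingPartialAction S (LocConstCompact X R) where
  D := T.supportIdeal R
  π := T.alpha R
  generate := T.supportIdeal_generate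
  image s t := by
    ext g
    constructor
    · rintro ⟨f, hf, rfl⟩
      have hf1 := T.mem_supportIdeal.1 f.2
      have hf2 := T.mem_supportIdeal.1 hf
      refine ⟨(T.alpha R s f).2, T.mem_supportIdeal.2 ?_⟩
      rw [alpha_coe, T.transport_support hf1]
      rintro _ ⟨z, hz, rfl⟩
      exact T.θ_mem_mul (hf1 hz) (hf2 hz)
    · rintro ⟨hg1, hg2⟩
      have hg2' := T.mem_supportIdeal.1 hg2
      have e : T.alpha R s ((T.alpha R s).symm ⟨g, hg1⟩) = ⟨g, hg1⟩ :=
        RingEquiv.apply_symm_apply _ _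
      refine ⟨(T.alpha R s).symm ⟨g, hg1⟩, T.mem_supportIdeal.2 fun x hx => ?_,
        congrArg Subtype.val e⟩
      set f := (T.alpha R s).symm ⟨g, hg1⟩
      have hxs := T.mem_supportIdeal.1 f.2 hx
      have hgx : T.θ s x ∈ Function.support (g : X → R) := by
        have : (g : X → R) = T.transport s f.1.1 := by
          rw [← alpha_coe, e]
        rw [this, T.transport_support (T.mem_supportIdeal.1 f.2)]
        exact ⟨x, hx, rfl⟩
      have h : T.θ s x ∈ T.dom s ∩ T.dom (s * t) := ⟨T.θ_mem hxs, hg2' hgx⟩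
      rw [← T.image] at h
      obtain ⟨z, hz, hzx⟩ := h
      rw [← T.θ_inj hz.1 hxs hzx]
      exact hz.2
  comp s t f hf hf' := by
    have h1 := T.mem_supportIdeal.1 hf
    have h2 := T.mem_supportIdeal.1 hf'
    have h3 : Function.support (f : X → R) ⊆ T.dom (s * t)⁻¹ := by rwa [mul_inv_rev']
    have h4 : Function.support (T.transport t (f : X → R)) ⊆ T.dom s⁻¹ := by
      rw [T.transport_support h1]
      rintro _ ⟨z, hz, rfl⟩
      exact (T.comp s t z ⟨h1 hz, h2 hz⟩).1
    refine ⟨T.mem_supportIdeal.2 h4, T.mem_supportIdeal.2 h3, Subtype.ext (funext fun x => ?_)⟩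
    show T.transport s (T.transport t (f : X → R)) x = T.transport (s * t) (f : X → R) x
    by_cases hx : x ∈ T.θ (s * t) '' Function.support (f : X → R)
    · obtain ⟨z, hz, rfl⟩ := hx
      have hc := T.comp s t z ⟨h1 hz, h2 hz⟩
      rw [T.transport_apply _ (h3 hz), ← hc.2, T.transport_apply _ hc.1,
        T.transport_apply _ (h1 hz)]
    · have hx1 : x ∉ Function.support (T.transport (s * t) (f : X → R)) := by
        rwa [T.transport_support h3]
      have hx2 : x ∉ Function.support (T.transport s (T.transport t (f : X → R))) := by
        rw [T.transport_support h4, T.transport_support h1]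
        rintro ⟨_, ⟨z, hz, rfl⟩, rfl⟩
        exact hx ⟨z, hz, (T.comp s t z ⟨h1 hz, h2 hz⟩).2.symm⟩
      rw [Function.notMem_support.1 hx1, Function.notMem_support.1 hx2]

end

end TopPartialAction

/-! ### The natural order seen from the left. -/

namespace InverseSemigroup

variable {S : Type*} [InverseSemigroup S]

/-! Topological principality. Let `F_s` be the set of points that `θ_s` fixes although no idempotent
below `s` is defined there (`nontrivialFixed`). The complement of `Λ(θ)` is the union of the `F_s`,
and each `F_s` is closed relative to the open set `X_{s⁻¹}`. As `S` is countable and `X` is a Baire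
space, it is enough that every `F_s` has empty interior. Otherwise some `F_s` contains a non-empty
compact open `K`. As `θ_s` is the identity on `K`, the class of `1_K δ_s` commutes with the
diagonal, so by hypothesis it lies in the diagonal. This is refuted by an additive functional: for
`x ∈ K`, sum the values `a_t(x)` over those `t` whose germ at `x` is a unit. It vanishes on the
ideal `𝓝`, and on the diagonal it agrees with evaluation of `τ` at `x`; but on `1_K δ_s` it gives
`0`, while `τ` gives `1`.

Ideals. In a non-zero ideal take a non-zero `f` that is a sum of as few homogeneous classes as
possible. An additive map that sends homogeneous classes to homogeneous classes, kills one term of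
`f` and maps `f` into the ideal must kill `f`, by minimality. A translation makes the degree of one
term idempotent. Commutators with diagonal elements then kill that term, since the coefficients
commute, so they kill `f`; thus `f` centralizes the diagonal and lies in it. A local unit `v` of
that term fixes `f` for the same reason, and on the diagonal multiplication by `v δ_e` gives `(v
τ(f)) δ_e`. Hence `τ(f) = 0` would force `f = 0` (`exists_tau_ne_zero`). -/

theorem idem_mul_le {f : S} (s : S) (hf : IsIdempotentElem f) : f * s ≤ s := by
  rw [le_def, mul_inv_rev', inv_of_idem hf]
  have hf' : f * f = f := hf
  symm
  calc s * (s⁻¹ * f) * (f * s) = (s * s⁻¹) * (f * f) * s := by simp only [mul_assoc]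
    _ = f * (s * s⁻¹ * s) := by
      rw [hf', idem_comm (mul_inv_idem s) hf]; simp only [mul_assoc]
    _ = f * s := by rw [mul_inv_mul]

theorem le_trans' {r s t : S} (h : r ≤ s) (h' : s ≤ t) : r ≤ t := by
  rw [le_def, mul_assoc] at h h'
  have e : r = t * ((s⁻¹ * s) * (r⁻¹ * r)) := by
    rw [← mul_assoc, ← h', ← h]
  rw [e]
  exact mul_idem_le t (mul_idem (inv_mul_idem s) (inv_mul_idem r))

/-- The order is defined by restricting on the right; since `r r⁻¹ = s (r⁻¹ r) s⁻¹`, the same `r` is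
also obtained by restricting `s` on the left. -/
theorem mul_inv_mul_eq_of_le {r s : S} (h : r ≤ s) : r * r⁻¹ * s = r := by
  rw [le_def, mul_assoc] at h
  have hi := inv_mul_idem r
  have e : r * r⁻¹ = s * (r⁻¹ * r) * s⁻¹ := by
    calc r * r⁻¹ = (s * (r⁻¹ * r)) * (s * (r⁻¹ * r))⁻¹ := by rw [← h]
      _ = s * ((r⁻¹ * r) * (r⁻¹ * r)) * s⁻¹ := by
        rw [mul_inv_rev', inv_of_idem hi]; simp only [mul_assoc]
      _ = s * (r⁻¹ * r) * s⁻¹ := by rw [show (r⁻¹ * r) * (r⁻¹ * r) = r⁻¹ * r from hi]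
  calc r * r⁻¹ * s = s * ((r⁻¹ * r) * (s⁻¹ * s)) := by rw [e]; simp only [mul_assoc]
    _ = (s * s⁻¹ * s) * (r⁻¹ * r) := by
      rw [idem_comm hi (inv_mul_idem s)]; simp only [mul_assoc]
    _ = r := by rw [mul_inv_mul, ← h]

end InverseSemigroup

/-! ### Diagonal multiplication in the skew ring, and elements of minimal length. -/

namespace RingPartialAction

variable {S A : Type*} [InverseSemigroup S] [NonUnitalRing A] (P : RingPartialAction S A)

theorem πInv_idem {e : S} (he : IsIdempotentElem e) (a : P.D e) : (P.πInv e a : A) = a :=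
  P.π_idem (by rwa [inv_of_idem he]) _

theorem coeffMul_idem_left {e : S} (he : IsIdempotentElem e) (t : S) (a : P.D e) (b : P.D t) :
    (P.coeffMul e t a b : A) = a * b := by
  show (P.π e _ : A) = _
  rw [P.π_idem he]
  show (P.πInv e a : A) * b = _
  rw [P.πInv_idem he]

theorem coeffMul_eq_self {s t : S} {a : P.D s} {b : P.D t}
    (h : (P.πInv s a : A) * b = P.πInv s a) : (P.coeffMul s t a b : A) = a := by
  have : (P.coeffMul s t a b : A) = P.π s (P.πInv s a) := by
    show (P.π s _ : A) = _
    congr 2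
    exact Subtype.ext h
  rw [this, P.π_πInv]

namespace SkewRing

/-- The class of `a δ_s`. -/
noncomputable def single (s : S) : P.D s →+ P.SkewRing where
  toFun a := mk P (Formal.single P s a)
  map_zero' := by rw [map_zero]; rfl
  map_add' a b := by rw [map_add]; rfl

theorem single_mul_single (s t : S) (a : P.D s) (b : P.D t) :
    single P s a * single P t b = single P (s * t) (P.coeffMul s t a b) :=
  congrArg (mk P) (Formal.single_mul_single P s t a b)

@[simp] theorem tau_single (s : S) (a : P.D s) : tau P (single P s a) = a :=
  Formal.tau_single P s a

theorem single_eq_of_le {r s : S} (h : r ≤ s) {a : P.D r} {b : P.D s} (hab : (a : A) = b) :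
    single P r a = single P s b := by
  obtain ⟨a, ha⟩ := a
  obtain ⟨b, hb⟩ := b
  obtain rfl : a = b := hab
  exact (RingCon.eq _).2 (((Formal.N P).rel_iff _ _).2
    (TwoSidedIdeal.subset_span ⟨r, s, a, ha, h, rfl⟩))

/-- Modulo `𝓝` the degree `e t ≤ t` may be replaced by `t`. With `single_mul_idem` this makes a
commutator of a diagonal class and a homogeneous class homogeneous, so commutators do not increase
length. -/
theorem single_idem_mul {e : S} (he : IsIdempotentElem e) (t : S) (a : P.D e) (b : P.D t) :
    single P e a * single P t b = single P t ⟨a * b, (P.D t).mul_mem_left _ _ b.2⟩ := by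
  rw [single_mul_single]
  exact single_eq_of_le P (idem_mul_le t he) (P.coeffMul_idem_left he t a b)

theorem single_mul_idem {e : S} (he : IsIdempotentElem e) (t : S) (a : P.D t) (b : P.D e) :
    single P t a * single P e b =
      single P t ⟨P.coeffMul t e a b, P.D_mono (mul_idem_le t he) (P.coeffMul t e a b).2⟩ := by
  rw [single_mul_single]
  exact single_eq_of_le P (mul_idem_le t he) rfl

theorem mem_centralizer_diagonal {x : P.SkewRing}
    (h : ∀ (e : S) (_ : IsIdempotentElem e) (a : P.D e),
      single P e a * x = x * single P e a) :
    x ∈ Set.centralizer (diagonal P : Set P.SkewRing) := by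
  intro d hd
  induction hd using AddSubmonoid.closure_induction with
  | mem d hd =>
    obtain ⟨e, he, a, rfl⟩ := hd
    exact h e he a
  | zero => rw [zero_mul, mul_zero]
  | add d d' _ _ hd hd' => rw [add_mul, mul_add, hd, hd']

/-- All degrees `e g` with `g` idempotent lie below `e`, so the terms of `d` collect into the single
degree `e`. Thus a diagonal element is controlled by its image under `tau`. -/
theorem single_idem_mul_diagonal {e : S} (he : IsIdempotentElem e) (c : P.D e)
    {d : P.SkewRing} (hd : d ∈ diagonal P) :
    single P e c * d = single P e ⟨c * tau P d, (P.D e).mul_mem_right _ _ c.2⟩ := by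
  induction hd using AddSubmonoid.closure_induction with
  | mem d hd =>
    obtain ⟨g, hg, a, rfl⟩ := hd
    change single P e c * single P g a = _
    rw [single_mul_single]
    refine single_eq_of_le P (mul_idem_le e hg) ?_
    rw [P.coeffMul_idem_left he]
    exact congrArg ((c : A) * ·) (tau_single P g a).symm
  | zero =>
    rw [mul_zero, ← map_zero (single P e)]
    congr 1
    exact Subtype.ext (by simp)
  | add d d' _ _ hd hd' =>
    rw [mul_add, hd, hd', ← map_add]
    congr 1
    exact Subtype.ext (by simp [mul_add])

/-- `x` is a sum of `n` classes of homogeneous elements. -/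
inductive IsSumOfSingles : ℕ → P.SkewRing → Prop
  | zero : IsSumOfSingles 0 0
  | cons {n : ℕ} (s : S) (a : P.D s) {x : P.SkewRing} :
      IsSumOfSingles n x → IsSumOfSingles (n + 1) (single P s a + x)

theorem IsSumOfSingles.add {m n : ℕ} {x y : P.SkewRing} (hx : IsSumOfSingles P m x)
    (hy : IsSumOfSingles P n y) : IsSumOfSingles P (m + n) (x + y) := by
  induction hx with
  | zero => rwa [zero_add, zero_add]
  | cons s a _ ih =>
    rw [add_assoc (single P s a), Nat.add_right_comm]
    exact ih.cons s a

theorem IsSumOfSingles.map {n : ℕ} {x : P.SkewRing} (hx : IsSumOfSingles P n x)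
    (φ : P.SkewRing →+ P.SkewRing)
    (hφ : ∀ s a, ∃ t b, φ (single P s a) = single P t b) : IsSumOfSingles P n (φ x) := by
  induction hx with
  | zero => rw [map_zero]; exact .zero
  | cons s a _ ih =>
    obtain ⟨t, b, h⟩ := hφ s a
    rw [map_add, h]
    exact ih.cons t b

theorem exists_isSumOfSingles (x : P.SkewRing) : ∃ n, IsSumOfSingles P n x := by
  obtain ⟨x, rfl⟩ := Quotient.exists_rep x
  induction x using Formal.induction P with
  | zero => exact ⟨0, .zero⟩
  | single s a =>
    have := IsSumOfSingles.zero.cons (P := P) s a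
    rw [add_zero] at this
    exact ⟨_, this⟩
  | add x y hx hy =>
    obtain ⟨m, hm⟩ := hx
    obtain ⟨n, hn⟩ := hy
    exact ⟨m + n, hm.add P hn⟩

/-- If the ideals `D s` have local units and the diagonal contains its centralizer, then `tau` does
not vanish on a non-zero ideal. -/
theorem exists_tau_ne_zero (hcomm : ∀ a b : A, a * b = b * a)
    (hunit : ∀ (s : S) (a : P.D s), ∃ u : P.D s, (u * a : A) = a)
    (hD : Set.centralizer (diagonal P : Set P.SkewRing) ⊆ diagonal P)
    (I : TwoSidedIdeal P.SkewRing) (hI : I ≠ ⊥) : ∃ f ∈ I, tau P f ≠ 0 := by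
  classical
  have hne : ∃ n, ∃ f ∈ I, f ≠ 0 ∧ IsSumOfSingles P n f := by
    by_contra! h
    refine hI (eq_bot_iff.2 fun f hf => ?_)
    rw [TwoSidedIdeal.mem_bot]
    by_contra hf0
    obtain ⟨n, hn⟩ := exists_isSumOfSingles P f
    exact h n f hf hf0 hn
  obtain ⟨f, hfI, hf0, hf⟩ := Nat.find_spec hne
  have hmin : ∀ m < Nat.find hne, ∀ g ∈ I, IsSumOfSingles P m g → g = 0 := by
    intro m hm g hg hgm
    by_contra hg0
    exact Nat.find_min hne hm ⟨g, hg, hg0, hgm⟩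
  -- A variable index is needed for case analysis on `hf`; the minimality survives in `hmin`.
  generalize Nat.find hne = k at hf hmin
  cases hf with
  | zero => exact absurd rfl hf0
  | @cons n s a x hx =>
  -- Such a `φ` maps the element to `φ x`, a sum of `n` homogeneous classes, one fewer than the
  -- minimum.
  have kill : ∀ (φ : P.SkewRing →+ P.SkewRing) (s : S) (a : P.D s) (x : P.SkewRing),
      IsSumOfSingles P n x → φ (single P s a + x) ∈ I → φ (single P s a) = 0 →
      (∀ s a, ∃ t b, φ (single P s a) = single P t b) → φ (single P s a + x) = 0 := by
    intro φ s a x hx hI h0 hφ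
    refine hmin n n.lt_succ_self _ hI ?_
    rw [map_add, h0, zero_add]
    exact hx.map P φ hφ
  -- `c` is chosen so that right multiplication by `c δ_{s⁻¹}` moves `a δ_s` to `a δ_{s s⁻¹}`, and
  -- `u` so that multiplication by `u δ_s` moves it back.
  obtain ⟨c, hc⟩ := hunit s⁻¹ (P.πInv s a)
  obtain ⟨u, hu⟩ := hunit s a
  rw [hcomm] at hc
  have he := mul_inv_idem s
  have ha : (a : A) ∈ P.D (s * s⁻¹) := P.mem_mul_inv a.2
  have hac : single P s a * single P s⁻¹ c = single P (s * s⁻¹) ⟨a, ha⟩ := by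
    rw [single_mul_single]
    congr 1
    exact Subtype.ext (P.coeffMul_eq_self hc)
  have hau : single P (s * s⁻¹) ⟨a, ha⟩ * single P s u = single P s a := by
    rw [single_idem_mul P he]
    congr 1
    apply Subtype.ext
    show (a * u : A) = a
    rw [hcomm, hu]
  -- Translating by `c δ_{s⁻¹}` keeps `f` non-zero.
  have hback : single P s a + x =
      (single P s a + x) * single P s⁻¹ c * single P s u := by
    have := kill (.id _ - (AddMonoidHom.mulRight (single P s u)).comp
      (AddMonoidHom.mulRight (single P s⁻¹ c))) s a x hx
      (I.sub_mem hfI (I.mul_mem_right _ _ (I.mul_mem_right _ _ hfI)))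
      (by
        show single P s a - single P s a * single P s⁻¹ c * single P s u = 0
        rw [hac, hau, sub_self])
      -- The round trip turns degree `t` into `t s⁻¹ s ≤ t`, which is absorbed into degree `t`; the
      -- difference is then homogeneous.
      (fun t b => by
        have hle : t * s⁻¹ * s ≤ t := by
          rw [mul_assoc]; exact mul_idem_le t (inv_mul_idem s)
        set d := P.coeffMul (t * s⁻¹) s (P.coeffMul t s⁻¹ b c) u
        refine ⟨t, b - ⟨d, P.D_mono hle d.2⟩, ?_⟩
        rw [map_sub]
        show single P t b - single P t b * single P s⁻¹ c * single P s u = _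
        rw [single_mul_single, single_mul_single]
        congr 1
        exact single_eq_of_le P hle rfl)
    exact sub_eq_zero.1 this
  set y := x * single P s⁻¹ c
  have hyn : IsSumOfSingles P n y :=
    hx.map P (AddMonoidHom.mulRight (single P s⁻¹ c))
      fun t b => ⟨_, _, single_mul_single P t s⁻¹ b c⟩
  set e := s * s⁻¹
  set f := single P e ⟨a, ha⟩ + y
  have hfeq : (single P s a + x) * single P s⁻¹ c = f := by rw [add_mul, hac]
  rw [hfeq] at hback
  have hfI' : f ∈ I := hfeq ▸ I.mul_mem_right _ _ hfI
  have hfne : f ≠ 0 := fun h => hf0 (by rw [hback, h, zero_mul])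
  have hfD : f ∈ diagonal P := by
    -- The commutator with `b δ_g` kills the term `a δ_e`: both products reduce to degree `e`, with
    -- coefficients `b a` and `a b`.
    refine hD (mem_centralizer_diagonal P fun g hg b => ?_)
    have := kill (AddMonoidHom.mulLeft (single P g b) - AddMonoidHom.mulRight (single P g b))
      e ⟨a, ha⟩ y hyn (I.sub_mem (I.mul_mem_left _ _ hfI') (I.mul_mem_right _ _ hfI'))
      (by
        show single P g b * single P e ⟨a, ha⟩ - single P e ⟨a, ha⟩ * single P g b = 0
        rw [single_idem_mul P hg, single_mul_idem P hg, sub_eq_zero]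
        congr 1
        apply Subtype.ext
        show (b * a : A) = P.coeffMul e g ⟨a, ha⟩ b
        rw [P.coeffMul_idem_left he, hcomm])
      (fun t d => by
        refine ⟨t, ⟨b * d, (P.D t).mul_mem_left _ _ d.2⟩ -
          ⟨P.coeffMul t g d b, P.D_mono (mul_idem_le t hg) (P.coeffMul t g d b).2⟩, ?_⟩
        rw [map_sub]
        show single P g b * single P t d - single P t d * single P g b = _
        rw [single_idem_mul P hg, single_mul_idem P hg])
    exact sub_eq_zero.1 this
  obtain ⟨v, hv⟩ := hunit e ⟨a, ha⟩
  -- Again by minimality: `v` fixes the one term `a δ_e`, so `vδ_e` fixes all of `f`.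
  have hvf : f = single P e v * f := by
    have := kill (.id _ - AddMonoidHom.mulLeft (single P e v)) e ⟨a, ha⟩ y hyn
      (I.sub_mem hfI' (I.mul_mem_left _ _ hfI'))
      (by
        show single P e ⟨a, ha⟩ - single P e v * single P e ⟨a, ha⟩ = 0
        rw [single_idem_mul P he, sub_eq_zero]
        congr 1
        exact Subtype.ext hv.symm)
      (fun t d => by
        refine ⟨t, d - ⟨v * d, (P.D t).mul_mem_left _ _ d.2⟩, ?_⟩
        rw [map_sub]
        show single P t d - single P e v * single P t d = _
        rw [single_idem_mul P he])
    exact sub_eq_zero.1 this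
  refine ⟨f, hfI', fun h0 => hfne ?_⟩
  rw [hvf, single_idem_mul_diagonal P he v hfD, ← map_zero (single P e)]
  congr 1
  exact Subtype.ext (by simp [h0])

end SkewRing

end RingPartialAction

/-! ### Unit germs, non-trivially fixed points and the Baire argument. -/

namespace TopPartialAction

variable {S X : Type*} [InverseSemigroup S] [TopologicalSpace X] (T : TopPartialAction S X)

theorem mem_dom_idem_mul {e f : S} (he : IsIdempotentElem e) {x : X} (hxe : x ∈ T.dom e)
    (hxf : x ∈ T.dom f) : x ∈ T.dom (e * f) := by
  have := T.θ_mem_mul (s := e) (t := f) (by rwa [inv_of_idem he]) hxf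
  rwa [T.θ_idem he hxe] at this

/-- `x` lies in the domain of an idempotent below `s`, that is, the germ of `s` at `x` is a unit. -/
def IsUnitAt (s : S) (x : X) : Prop :=
  ∃ e : S, IsIdempotentElem e ∧ e ≤ s ∧ x ∈ T.dom e

/-- Over `X_r` the elements `r` and `s` have the same germs: if `e ≤ s` is idempotent, then `r r⁻¹
e` is an idempotent below `r r⁻¹ s = r`. This is what makes the functional `unitEval` vanish on `𝓝`.
-/
theorem isUnitAt_iff_of_le {r s : S} (h : r ≤ s) {x : X} (hx : x ∈ T.dom r) :
    T.IsUnitAt r x ↔ T.IsUnitAt s x := by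
  constructor
  · rintro ⟨e, he, hle, hxe⟩
    exact ⟨e, he, le_trans' hle h, hxe⟩
  · rintro ⟨e, he, hle, hxe⟩
    have hr := mul_inv_idem r
    refine ⟨r * r⁻¹ * e, mul_idem hr he, ?_, T.mem_dom_idem_mul hr (T.mem_mul_inv hx) hxe⟩
    have := mul_le_left (r * r⁻¹) hle
    rwa [mul_inv_mul_eq_of_le h] at this

/-- The points fixed by `s` at which the germ of `s` is not a unit. -/
def nontrivialFixed (s : S) : Set X :=
  {x | x ∈ T.dom s⁻¹ ∧ T.θ s x = x ∧ ¬ T.IsUnitAt s x}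

/-- Inside `X_{s⁻¹}` both conditions are closed: being fixed because `X` is Hausdorff, having a
non-unit germ because the domains `X_e` are open. -/
theorem mem_nontrivialFixed_of_mem_closure [T2Space X] {s : S} {x : X} (hx : x ∈ T.dom s⁻¹)
    (hx' : x ∈ closure (T.nontrivialFixed s)) : x ∈ T.nontrivialFixed s := by
  refine ⟨hx, ?_, ?_⟩
  · have hcont : ContinuousAt (T.θ s) x := (T.θ s).continuousAt (by rwa [T.source_eq])
    rw [mem_closure_iff_frequently] at hx'
    by_contra hne
    have hev := (hcont.ne_iff_eventually_ne continuousAt_id).1 hne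
    obtain ⟨y, hy, hy'⟩ := (hx'.and_eventually hev).exists
    exact hy' hy.2.1
  · rintro ⟨e, he, hle, hxe⟩
    obtain ⟨y, hye, hy⟩ := mem_closure_iff.1 hx' _ (T.isOpen_dom e) hxe
    exact hy.2.2 ⟨e, he, hle, hye⟩

theorem isTopologicallyPrincipal_of_interior_eq_empty [Countable S] [T2Space X] [BaireSpace X]
    (h : ∀ s, interior (T.nontrivialFixed s) = ∅) : T.IsTopologicallyPrincipal := by
  have hd : Dense (⋂ s, (closure (T.nontrivialFixed s))ᶜ) := by
    refine dense_iInter_of_isOpen (fun s => isClosed_closure.isOpen_compl) fun s => ?_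
    rw [← interior_eq_empty_iff_dense_compl, Set.eq_empty_iff_forall_notMem]
    intro x hx
    obtain ⟨y, hy, hyf⟩ := mem_closure_iff.1 (interior_subset hx) _ isOpen_interior hx
    -- An open subset of the closure, cut down to `X_{s⁻¹}`, lies in the set itself; so an interior
    -- point of the closure would yield one of the set.
    have hV : interior (closure (T.nontrivialFixed s)) ∩ T.dom s⁻¹ ⊆ T.nontrivialFixed s :=
      fun z hz => T.mem_nontrivialFixed_of_mem_closure hz.2 (interior_subset hz.1)
    have : y ∈ interior (T.nontrivialFixed s) :=
      interior_maximal hV (isOpen_interior.inter (T.isOpen_dom _)) ⟨hy, hyf.1⟩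
    rwa [h s] at this
  refine hd.mono fun x hx s hxs hfix => ?_
  by_contra hu
  exact Set.mem_iInter.1 hx s (subset_closure ⟨hxs, hfix, hu⟩)

/-! ### Local units, the unit-germ functional and the element `1_K δ_s`. -/

variable [T2Space X] {R : Type*} [CommRing R]

theorem indicator_one_mem {K : Set X} (hK : IsClopen K) (hc : IsCompact K) :
    K.indicator (1 : X → R) ∈ LocConstCompact X R := by
  have h : IsLocallyConstant (K.indicator (1 : X → R)) :=
    (LocallyConstant.indicator (1 : LocallyConstant X R) hK).isLocallyConstant
  exact ⟨h, hc.of_isClosed_subset (h.isClopen_fiber 0).compl.1 Set.support_indicator_subset⟩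

/-- The support of `a` is compact and clopen, so its indicator serves as the unit. -/
theorem exists_local_unit (s : S) (a : T.supportIdeal R s) :
    ∃ u : T.supportIdeal R s, (u * a : LocConstCompact X R) = a := by
  have ha := a.1.2
  have hK := (ha.1.isClopen_fiber 0).compl
  refine ⟨⟨⟨_, indicator_one_mem hK ha.2⟩, T.mem_supportIdeal.2 ?_⟩, ?_⟩
  · exact Set.support_indicator_subset.trans (T.mem_supportIdeal.1 a.2)
  · apply Subtype.ext
    funext x
    show Set.indicator _ (1 : X → R) x * a.1.1 x = a.1.1 x
    by_cases hx : a.1.1 x = 0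
    · rw [hx, mul_zero]
    · rw [Set.indicator_of_mem hx, Pi.one_apply, one_mul]

/-- Evaluation at `x` as an additive map. -/
def evalHom (x : X) : LocConstCompact X R →+ R where
  toFun f := f.1 x
  map_zero' := rfl
  map_add' _ _ := rfl

variable [PrespectralSpace X]

variable (R) in
open Classical in
/-- The sum of the values at `x` of the coefficients whose germ at `x` is a unit. -/
noncomputable def unitEval (x : X) : (T.toRingPartialAction R).Formal →+ R :=
  RingPartialAction.Formal.lift _ fun s =>
    if T.IsUnitAt s x then (evalHom x).comp ((T.toRingPartialAction R).D s).coeAddMonoidHom else 0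

open Classical in
theorem unitEval_single (x : X) (s : S) (a : (T.toRingPartialAction R).D s) :
    T.unitEval R x (RingPartialAction.Formal.single _ s a) =
      if T.IsUnitAt s x then a.1.1 x else 0 := by
  rw [unitEval, RingPartialAction.Formal.lift_single]
  split_ifs <;> rfl

/-- The functional is not multiplicative, so it matters that `𝓝` is already the additive span of its
generators. On `a δ_r - a δ_s` either `x ∈ X_r` and both germs are units or neither is, or `a(x) =
0`. -/
theorem unitEval_eq_zero (x : X) {f : (T.toRingPartialAction R).Formal}
    (hf : f ∈ RingPartialAction.Formal.N (T.toRingPartialAction R)) : T.unitEval R x f = 0 := by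
  classical
  have h : AddSubgroup.closure (RingPartialAction.Formal.nGen (T.toRingPartialAction R)) ≤
      (T.unitEval R x).ker := by
    rw [AddSubgroup.closure_le]
    rintro _ ⟨r, s, a, hr, h, rfl⟩
    simp only [SetLike.mem_coe, AddMonoidHom.mem_ker]
    rw [map_sub, unitEval_single, unitEval_single]
    by_cases hx : x ∈ T.dom r
    · rw [if_congr (T.isUnitAt_iff_of_le h hx) rfl rfl, sub_self]
    · have : a.1 x = 0 := by
        by_contra h0
        exact hx (T.mem_supportIdeal.1 hr h0)
      simp [this]
  exact h (RingPartialAction.Formal.mem_closure_of_mem_N _ hf)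

variable (R) in
/-- The map induced by `unitEval` on the skew inverse semigroup ring. -/
noncomputable def skewUnitEval (x : X) : (T.toRingPartialAction R).SkewRing →+ R where
  toFun := Quotient.lift (T.unitEval R x) fun f g h => by
    have := T.unitEval_eq_zero x
      (((RingPartialAction.Formal.N (T.toRingPartialAction R)).rel_iff f g).1 h)
    rwa [map_sub, sub_eq_zero] at this
  map_zero' := map_zero (T.unitEval R x)
  map_add' f g := Quotient.inductionOn₂ f g fun a b => map_add (T.unitEval R x) a b

open Classical in
theorem skewUnitEval_single (x : X) (s : S) (a : (T.toRingPartialAction R).D s) :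
    T.skewUnitEval R x (RingPartialAction.SkewRing.single _ s a) =
      if T.IsUnitAt s x then a.1.1 x else 0 :=
  T.unitEval_single x s a

theorem skewUnitEval_diagonal (x : X) {d : (T.toRingPartialAction R).SkewRing}
    (hd : d ∈ RingPartialAction.SkewRing.diagonal (T.toRingPartialAction R)) :
    T.skewUnitEval R x d = evalHom x (RingPartialAction.SkewRing.tau _ d) := by
  classical
  induction hd using AddSubmonoid.closure_induction with
  | mem d hd =>
    obtain ⟨e, he, a, rfl⟩ := hd
    refine (T.skewUnitEval_single x e a).trans ?_
    refine Eq.trans ?_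
      (congrArg (evalHom x) (RingPartialAction.SkewRing.tau_single _ e a)).symm
    change _ = a.1.1 x
    split_ifs with h
    · rfl
    -- If the germ of `e` at `x` is not a unit then `x ∉ X_e`, so `a(x) = 0` and nothing is lost.
    · by_contra h0
      refine h ⟨e, he, ?_, T.mem_supportIdeal.1 a.2 (Ne.symm h0)⟩
      rw [le_def, mul_assoc, inv_of_idem he]
      exact ((congrArg (e * ·) he).trans he).symm
  | zero => simp only [map_zero]
  | add d d' _ _ hd hd' => simp only [map_add, hd, hd']

theorem interior_nontrivialFixed_eq_empty [Nontrivial R]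
    (hD : Set.centralizer (RingPartialAction.SkewRing.diagonal (T.toRingPartialAction R) :
      Set (T.toRingPartialAction R).SkewRing) ⊆
        RingPartialAction.SkewRing.diagonal (T.toRingPartialAction R))
    (s : S) : interior (T.nontrivialFixed s) = ∅ := by
  classical
  rw [Set.eq_empty_iff_forall_notMem]
  intro x hx
  obtain ⟨K, ⟨hKo, hKc⟩, hxK, hK⟩ :=
    PrespectralSpace.isTopologicalBasis.exists_subset_of_mem_open hx isOpen_interior
  replace hK := hK.trans interior_subset
  have hKs : K ⊆ T.dom s := fun y hy => by
    have := T.θ_mem (hK hy).1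
    rwa [(hK hy).2.1] at this
  let P := T.toRingPartialAction R
  let a : P.D s := ⟨⟨_, indicator_one_mem ⟨hKc.isClosed, hKo⟩ hKc⟩,
    T.mem_supportIdeal.2 (Set.support_indicator_subset.trans hKs)⟩
  -- `α_{s⁻¹}` fixes `1_K`: `θ_s` is the identity on `K`, and by injectivity it sends no point
  -- outside `K` into `K`.
  have hainv : ((P.πInv s a : LocConstCompact X R) : X → R) = K.indicator 1 := by
    funext y
    show T.transport s⁻¹ (K.indicator (1 : X → R)) y = _
    by_cases hy : y ∈ T.dom s⁻¹
    · rw [transport, if_pos hy, inv_inv']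
      by_cases hyK : y ∈ K
      · rw [(hK hyK).2.1]
      · rw [Set.indicator_of_notMem hyK, Set.indicator_of_notMem]
        intro h
        exact hyK (T.θ_inj hy (hK h).1 (hK h).2.1.symm ▸ h)
    · rw [T.transport_of_notMem _ hy, Set.indicator_of_notMem fun h => hy (hK h).1]
  have hmem : RingPartialAction.SkewRing.single P s a ∈
      RingPartialAction.SkewRing.diagonal P := by
    refine hD (RingPartialAction.SkewRing.mem_centralizer_diagonal P fun e he b => ?_)
    rw [RingPartialAction.SkewRing.single_idem_mul P he,
      RingPartialAction.SkewRing.single_mul_idem P he]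
    congr 1
    apply Subtype.ext
    apply Subtype.ext
    funext y
    -- Commuting with `b δ_e` comes down to `b 1_K = α_s(1_K b)`, which holds because `θ_s` fixes
    -- `K` pointwise and both sides vanish off `K`.
    show b.1.1 y * K.indicator 1 y = T.transport s
      (((P.πInv s a : LocConstCompact X R) : X → R) * b.1.1) y
    rw [hainv]
    by_cases hy : y ∈ K
    · have h := T.transport_apply (K.indicator (1 : X → R) * b.1.1) (hK hy).1
      rw [(hK hy).2.1] at h
      rw [h, Pi.mul_apply, mul_comm]
    · rw [Set.indicator_of_notMem hy, mul_zero]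
      by_cases hys : y ∈ T.dom s
      · rw [transport, if_pos hys, Pi.mul_apply, Set.indicator_of_notMem, zero_mul]
        intro h
        refine hy ?_
        have h1 := (T.θ_θ_inv hys).2
        rw [(hK h).2.1] at h1
        exact h1 ▸ h
      · rw [T.transport_of_notMem _ hys]
  -- The germ of `s` at `x ∈ K` is not a unit, so the functional gives `0`, whereas `τ` evaluates to
  -- `1_K(x) = 1`.
  have h1 := T.skewUnitEval_diagonal x hmem
  rw [T.skewUnitEval_single, if_neg (hK hxK).2.2] at h1
  have h2 : evalHom x (RingPartialAction.SkewRing.tau P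
      (RingPartialAction.SkewRing.single P s a)) = (1 : R) := by
    rw [RingPartialAction.SkewRing.tau_single]
    exact Set.indicator_of_mem hxK _
  exact zero_ne_one (h1.trans h2)

end TopPartialAction

theorem proposition4p12 {S X R : Type*} [InverseSemigroup S] [Countable S]
    [TopologicalSpace X] [T2Space X] [LocallyCompactSpace X] [SecondCountableTopology X]
    [PrespectralSpace X] [CommRing R] [Nontrivial R] (T : TopPartialAction S X)
    (hD : IsMaximalCommutative
      (RingPartialAction.SkewRing.diagonal (T.toRingPartialAction R) :
        Set (T.toRingPartialAction R).SkewRing)) :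
    T.IsTopologicallyPrincipal ∧
      ∀ I : TwoSidedIdeal (T.toRingPartialAction R).SkewRing, I ≠ ⊥ →
        ∃ f ∈ I, (Function.support
          (RingPartialAction.SkewRing.tau (T.toRingPartialAction R) f : X → R)).Nonempty := by
  have hD' := hD.subset
  refine ⟨T.isTopologicallyPrincipal_of_interior_eq_empty fun s =>
    T.interior_nontrivialFixed_eq_empty hD' s, fun I hI => ?_⟩
  obtain ⟨f, hf, hne⟩ := RingPartialAction.SkewRing.exists_tau_ne_zero
    (T.toRingPartialAction R) mul_comm T.exists_local_unit hD' I hI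
  refine ⟨f, hf, Function.support_nonempty_iff.2 fun h => hne (Subtype.ext h)⟩
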